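/- Let $E$ be a real Banach space with dual $E^*$ and bidual $E^{**}$, let $\langle x,x^*\rangle$ and $\langle x^*,x^{**}\rangle$ denote the canonical pairings, and let $\widehat{x}\in E^{**}$ denote the canonical image of $x\in E$, so that $\langle x^*,\widehat{x}\rangle=\langle x,x^*\rangle$. Let $S\colon E\rightrightarrows E^*$ be a multifunction with graph $G(S)=\{(x,x^*): x^*\in S(x)\}$. We say that $S$ is closed if $G(S)$ is norm-closed in $E\times E^*$, monotone if $\langle s-t,s^*-t^*\rangle\ge 0$ for all $(s,s^*),(t,t^*)\in G(S)$, and quasidense if, for all $(x,x^*)\in E\times E^*$, $$\inf_{(s,s^*)\in G(S)}\Big[\tfrac12\|s-x\|^2+\tfrac12\|s^*-x^*\|^2+\langle s-x,s^*-x^*\rangle\Big]\le 0,$$ where $\inf\emptyset=+\infty$. If $S$ is closed, monotone and quasidense, let $\varphi_S(x,x^*)=\sup_{(s,s^*)\in G(S)}\big[\langle s,x^*\rangle+\langle x,s^*\rangle-\langle s,s^*\rangle\big]$, and let $$\varphi_S^*(y^*,y^{**})=\sup_{(x,x^*)\in E\times E^*}\big[\langle x,y^*\rangle+\langle x^*,y^{**}\rangle-\varphi_S(x,x^*)\big].$$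 The Fitzpatrick extension of $S$ is the multifunction $S^{\mathbb F}\colon E^*\rightrightarrows E^{**}$ with graph $$G(S^{\mathbb F})=\{(y^*,y^{**})\in E^*\times E^{**}: \varphi_S^*(y^*,y^{**})=\langle y^*,y^{**}\rangle\}.$$ Let $K\subset E$ be nonempty, convex and compact in the weak topology $w(E,E^*)$, and put $\widehat{K}=\{\widehat{x}: x\in K\}$. Let $\mathbb I_K$ be the function equal to $0$ on $K$ and $+\infty$ on $E\setminus K$, with Fenchel conjugate $\mathbb I_K^*(x^*)=\sup_{x\in E}[\langle x,x^*\rangle-\mathbb I_K(x)]$, and let $\partial\mathbb I_K\colon E\rightrightarrows E^*$ be its subdifferential (the normal cone multifunction of $K$), defined by $x^*\in\partial\mathbb I_K(x)\iff \mathbb I_K(x)+\mathbb I_K^*(x^*)=\langle x,x^*\rangle$. Then $\partial\mathbb I_K$ is closed, monotone and quasidense, so that its Fitzpatrick extension $(\partial\mathbb I_K)^{\mathbb F}$ is defined, and for all $(y^*,y^{**})\in E^*\times E^{**}$, $$(y^*,y^{**})\in G\big((\partial\mathbb I_K)^{\mathbb F}\big)\iff y^{**}\in\widehat{K}\ \text{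 and }\ \langle y^*,y^{**}\rangle=\sup_{x\in K}\langle x,y^*\rangle .$$ -/

import Mathlib

noncomputable section

namespace FitzpatrickExt

/-- The graph `G(S)` of a multifunction `S : X ⇉ Y`. -/
def graph {X Y : Type*} (S : X → Set Y) : Set (X × Y) :=
  {p | p.2 ∈ S p.1}

section Normed

variable {X : Type*} [NormedAddCommGroup X] [NormedSpace ℝ X]

/-- The Fenchel conjugate `f*(x*) = sup_{x ∈ X} [⟨x, x*⟩ - f(x)]` on the dual of `X`. -/
def conjugate (f : X → EReal) (x' : StrongDual ℝ X) : EReal :=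
  ⨆ x : X, ((x' x : ℝ) : EReal) - f x

/-- The subdifferential: `x* ∈ ∂f(x)` iff `f(x) + f*(x*) = ⟨x, x*⟩`. -/
def subdifferential (f : X → EReal) (x : X) : Set (StrongDual ℝ X) :=
  {x' | f x + conjugate f x' = ((x' x : ℝ) : EReal)}

open Classical in
/-- The indicator function of `K`: `0` on `K` and `+∞` off `K`. -/
def indicatorFun (K : Set X) (x : X) : EReal :=
  if x ∈ K then 0 else ⊤

/-- The normal cone multifunction of `K`: the subdifferential of the indicator function of `K`. -/
def normalCone (K : Set X) : X → Set (StrongDual ℝ X) :=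
  subdifferential (indicatorFun K)

/-- `K` is compact in the weak topology `w(X, X*)`. -/
def IsWeaklyCompact (K : Set X) : Prop :=
  IsCompact (toWeakSpace ℝ X '' K)

/-- The multifunction `S : X ⇉ X*` is closed (for the norm topologies). -/
def ClosedMultifunction (S : X → Set (StrongDual ℝ X)) : Prop :=
  IsClosed (graph S)

/-- The multifunction `S : X ⇉ X*` is monotone. -/
def MonotoneMultifunction (S : X → Set (StrongDual ℝ X)) : Prop :=
  ∀ p ∈ graph S, ∀ q ∈ graph S, 0 ≤ (p.2 - q.2) (p.1 - q.1)

/-- The multifunction `S : X ⇉ X*` is quasidense. The infimum is taken in the extended reals. -/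
def Quasidense (S : X → Set (StrongDual ℝ X)) : Prop :=
  ∀ (x : X) (x' : StrongDual ℝ X),
    (⨅ p ∈ graph S,
      (((1 / 2 : ℝ) * ‖p.1 - x‖ ^ 2 + (1 / 2 : ℝ) * ‖p.2 - x'‖ ^ 2
        + (p.2 - x') (p.1 - x) : ℝ) : EReal)) ≤ 0

/-- The Fitzpatrick function
`φ_S(x, x*) = sup_{(s, s*) ∈ G(S)} [⟨s, x*⟩ + ⟨x, s*⟩ - ⟨s, s*⟩]`. -/
def fitzpatrickFunction (S : X → Set (StrongDual ℝ X)) (p : X × StrongDual ℝ X) : EReal :=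
  ⨆ s ∈ graph S, ((p.2 s.1 + s.2 p.1 - s.2 s.1 : ℝ) : EReal)

/-- The Fitzpatrick extension `S^F : X* ⇉ X**` of a closed, monotone, quasidense `S : X ⇉ X*`:
`y** ∈ S^F(y*)` iff `φ_S*(y*, y**) = ⟨y*, y**⟩`. A pair `(y*, y**)` is identified with the
functional `(x, x*) ↦ ⟨x, y*⟩ + ⟨x*, y**⟩` on `X × X*`, which is `y'.coprod y''`. -/
def fitzpatrickExtension (S : X → Set (StrongDual ℝ X)) (y' : StrongDual ℝ X) :
    Set (StrongDual ℝ (StrongDual ℝ X)) :=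
  {y'' | conjugate (fitzpatrickFunction S) (y'.coprod y'') = ((y'' y' : ℝ) : EReal)}

end Normed

end FitzpatrickExt

end

/-!
The Fenchel conjugate of the indicator function `I_K` is the support function `σ_K`, a sublinear
function on `E*`. For every `f`, the Fitzpatrick function of `∂f` is at most `f(x) + f*(x*)`, so
conjugating gives `(∂f)^F ⊆ ∂(f*)`. For `f = I_K` this says that `y**` is dominated by `σ_K` and
`⟨y*, y**⟩ = σ_K(y*)`; by separation in `w(E**, E*)`, where `K̂` is compact, domination by `σ_K`
means `y** ∈ K̂`. Conversely, the Fitzpatrick extension of a monotone multifunction contains its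
graph.

For quasidensity at `(x, x*)`, minimise `½‖· - x‖² - x*` over the weakly compact set `K`. At a
minimiser `s` the sum rule splits `x*` into a subgradient `p` of `½‖· - x‖²` at `s` and a normal
`x* - p` to `K` at `s`; the quasidensity expression at `(s, x* - p)` is then nonpositive.
-/

namespace FitzpatrickExt

section Convexity

variable {E : Type*} [AddCommGroup E] [Module ℝ E] [TopologicalSpace E] [IsTopologicalAddGroup E]
  [ContinuousSMul ℝ E]

theorem exists_affine_between_concaveOn_convexOn {s : Set E} {f g : E → ℝ}
    (hf : ConvexOn ℝ Set.univ f) (hfc : Continuous f) (hs : s.Nonempty) (hg : ConcaveOn ℝ s g)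
    (hgf : ∀ x ∈ s, g x ≤ f x) :
    ∃ (p : StrongDual ℝ E) (c : ℝ), (∀ x, p x + c ≤ f x) ∧ ∀ x ∈ s, g x ≤ p x + c := by
  have hepi : Convex ℝ {q : E × ℝ | f q.1 < q.2} := by simpa using hf.convex_strict_epigraph
  have hepi_open : IsOpen {q : E × ℝ | f q.1 < q.2} :=
    isOpen_lt (hfc.comp continuous_fst) continuous_snd
  have hdisj : Disjoint {q : E × ℝ | f q.1 < q.2} {q : E × ℝ | q.1 ∈ s ∧ q.2 ≤ g q.1} :=
    Set.disjoint_left.2 fun q hfq hq => (hfq.trans_le (hq.2.trans (hgf _ hq.1))).false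
  obtain ⟨F, u, hF_epi, hF_hypo⟩ :=
    geometric_hahn_banach_open hepi hepi_open hg.convex_hypograph hdisj
  obtain ⟨a, α, hF⟩ : ∃ (a : StrongDual ℝ E) (α : ℝ), ∀ x t, F (x, t) = a x - α * t := by
    refine ⟨F.comp (.inl ℝ E ℝ), -F (0, 1), fun x t => ?_⟩
    have h : (x, t) = (x, 0) + t • ((0 : E), (1 : ℝ)) := by simp
    rw [h, map_add, map_smul, smul_eq_mul]
    simp [mul_comm]
  have hepi_lt (x : E) (t : ℝ) (ht : f x < t) : a x - α * t < u := hF x t ▸ hF_epi (x, t) ht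
  have hle_hypo (x : E) (hx : x ∈ s) : u ≤ a x - α * g x := hF x _ ▸ hF_hypo (x, g x) ⟨hx, le_rfl⟩
  have hα : 0 < α := by
    obtain ⟨x, hx⟩ := hs
    have hgap : α * g x < α * (f x + 1) := by linarith [hepi_lt x _ (lt_add_one _), hle_hypo x hx]
    by_contra! hα
    linarith [mul_le_mul_of_nonpos_left ((hgf x hx).trans (lt_add_one _).le) hα]
  refine ⟨α⁻¹ • a, -(α⁻¹ * u), fun x => ?_, fun x hx => ?_⟩
  · refine le_of_forall_gt_imp_ge_of_dense fun t ht => ?_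
    calc α⁻¹ * a x + -(α⁻¹ * u) = α⁻¹ * (a x - u) := by ring
      _ ≤ t := (inv_mul_le_iff₀ hα).2 (by linarith [hepi_lt x t ht])
  · calc g x ≤ α⁻¹ * (a x - u) := (le_inv_mul_iff₀ hα).2 (by linarith [hle_hypo x hx])
      _ = α⁻¹ * a x + -(α⁻¹ * u) := by ring

theorem lowerSemicontinuous_comp_toWeakSpace_symm [LocallyConvexSpace ℝ E] {f : E → ℝ}
    (hf : ConvexOn ℝ Set.univ f) (hfc : LowerSemicontinuous f) :
    LowerSemicontinuous (f ∘ (toWeakSpace ℝ E).symm) := by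
  refine lowerSemicontinuous_iff_isClosed_preimage.2 fun c => ?_
  have hconv : Convex ℝ (f ⁻¹' Set.Iic c) := by
    simpa [Set.preimage] using hf.convex_le c
  have hclosure := hconv.toWeakSpace_closure ℝ
  rw [(hfc.isClosed_preimage c).closure_eq, LinearEquiv.image_eq_preimage_symm] at hclosure
  exact isClosed_of_closure_subset hclosure.symm.subset

theorem exists_forall_lt_of_notMem_weakDual {F : Type*} [AddCommGroup F] [Module ℝ F]
    [TopologicalSpace F] {s : Set (WeakDual ℝ F)} (hs : Convex ℝ s) (hsc : IsClosed s)
    {φ : WeakDual ℝ F} (hφ : φ ∉ s) :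
    ∃ (x : F) (b : ℝ), (∀ ψ ∈ s, ψ x < b) ∧ b < φ x := by
  have : LocallyConvexSpace ℝ (WeakDual ℝ F) :=
    inferInstanceAs (LocallyConvexSpace ℝ (WeakBilin (topDualPairing ℝ F)))
  obtain ⟨G, b, hGb, hbG⟩ := geometric_hahn_banach_closed_point hs hsc hφ
  obtain ⟨x, rfl⟩ := (topDualPairing ℝ F).dualEmbedding_surjective G
  exact ⟨x, b, hGb, hbG⟩

end Convexity

theorem half_norm_sq_le_of_forall_sub_half_norm_sq_le {E : Type*} [SeminormedAddCommGroup E]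
    [NormedSpace ℝ E] {p : StrongDual ℝ E} {c : ℝ}
    (h : ∀ x, p x - (1 / 2 : ℝ) * ‖x‖ ^ 2 ≤ c) : (1 / 2 : ℝ) * ‖p‖ ^ 2 ≤ c := by
  have hc : 0 ≤ c := by simpa using h 0
  have hp_sq (x : E) : (p x) ^ 2 ≤ 2 * c * ‖x‖ ^ 2 := by
    have hquad (t : ℝ) : 0 ≤ (1 / 2 : ℝ) * ‖x‖ ^ 2 * (t * t) + -p x * t + c := by
      have ht := h (t • x)
      rw [map_smul, smul_eq_mul, norm_smul, mul_pow, Real.norm_eq_abs, sq_abs] at ht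
      linarith
    have hdiscrim := discrim_le_zero hquad
    rw [discrim] at hdiscrim
    linarith
  have hp : ‖p‖ ≤ √(2 * c) := p.opNorm_le_bound (Real.sqrt_nonneg _) fun x => by
    simpa using Real.abs_le_sqrt (hp_sq x)
  linarith [(Real.le_sqrt (norm_nonneg p) (by positivity)).1 hp]

section Subdifferential

variable {E : Type*} [NormedAddCommGroup E] [NormedSpace ℝ E] {f : E → EReal} {x : E}
  {x' : StrongDual ℝ E}

theorem conjugate_le_coe_iff {c : ℝ} :
    conjugate f x' ≤ c ↔ ∀ z, ((x' z - c : ℝ) : EReal) ≤ f z := by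
  refine iSup_le_iff.trans (forall_congr' fun z => ?_)
  rw [EReal.coe_sub, EReal.sub_le_iff_le_add (.inr (EReal.coe_ne_top c))
    (.inr (EReal.coe_ne_bot c)), EReal.sub_le_iff_le_add (.inl (EReal.coe_ne_bot c))
    (.inl (EReal.coe_ne_top c)), add_comm]

theorem coe_sub_le_conjugate {a : ℝ} (hx : f x = a) (x' : StrongDual ℝ E) :
    ((x' x - a : ℝ) : EReal) ≤ conjugate f x' :=
  le_iSup_of_le x (by rw [hx, EReal.coe_sub])

theorem conjugate_le_coe_sub_iff {a : ℝ} :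
    conjugate f x' ≤ (x' x - a : ℝ) ↔ ∀ z, ((a + x' (z - x) : ℝ) : EReal) ≤ f z := by
  simp only [conjugate_le_coe_iff, map_sub, sub_sub_eq_add_sub, add_sub_assoc', add_comm]

theorem mem_subdifferential_iff_conjugate_eq :
    x' ∈ subdifferential f x ↔ ∃ a : ℝ, f x = a ∧ conjugate f x' = (x' x - a : ℝ) := by
  change f x + conjugate f x' = (x' x : ℝ) ↔ _
  constructor
  · intro h
    obtain ⟨a, ha⟩ : ∃ a : ℝ, f x = a := by
      induction hfx : f x with
      | bot => simp [hfx] at h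
      | coe a => exact ⟨a, rfl⟩
      | top => induction hfx' : conjugate f x' <;> simp [hfx, hfx'] at h
    exact ⟨a, ha, by rw [EReal.coe_sub, ← h, ha, EReal.add_sub_cancel_left]⟩
  · rintro ⟨a, ha, hconj⟩
    rw [ha, hconj, ← EReal.coe_add, add_sub_cancel]

theorem mem_subdifferential_iff :
    x' ∈ subdifferential f x ↔
      ∃ a : ℝ, f x = a ∧ ∀ z, ((a + x' (z - x) : ℝ) : EReal) ≤ f z := by
  rw [mem_subdifferential_iff_conjugate_eq]
  refine exists_congr fun a => and_congr_right fun ha => ?_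
  rw [← conjugate_le_coe_sub_iff]
  exact ⟨le_of_eq, fun h => h.antisymm (coe_sub_le_conjugate ha x')⟩

theorem mem_subdifferential_coe_iff {h : E → ℝ} :
    x' ∈ subdifferential (fun z => (h z : EReal)) x ↔ ∀ z, h x + x' (z - x) ≤ h z := by
  simp [mem_subdifferential_iff, -EReal.coe_add]

theorem mem_subdifferential_iff_of_sublinear (hzero : f 0 ≤ 0)
    (hadd : ∀ z w, f (z + w) ≤ f z + f w) :
    x' ∈ subdifferential f x ↔ (∀ z, (x' z : EReal) ≤ f z) ∧ (x' x : EReal) = f x := by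
  rw [mem_subdifferential_iff]
  constructor
  · rintro ⟨a, ha, hsub⟩
    have hle (z : E) : (x' z : EReal) ≤ f z := by
      refine (EReal.addLECancellable_coe a).add_le_add_iff_left.1 ?_
      calc (a : EReal) + (x' z : ℝ) = (a + x' (x + z - x) : ℝ) := by simp
        _ ≤ f (x + z) := hsub (x + z)
        _ ≤ a + f z := ha ▸ hadd x z
    have ha_le : a ≤ x' x := by
      have h : a + x' (0 - x) ≤ 0 := EReal.coe_le_coe_iff.1 ((hsub 0).trans hzero)
      simpa [← sub_eq_add_neg] using h
    refine ⟨hle, le_antisymm (hle x) ?_⟩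
    rw [ha]
    exact_mod_cast ha_le
  · rintro ⟨hle, hx⟩
    exact ⟨x' x, hx.symm, by simpa using hle⟩

theorem monotoneMultifunction_subdifferential (f : E → EReal) :
    MonotoneMultifunction (subdifferential f) := by
  intro p hp q hq
  obtain ⟨a, ha, hpa⟩ := mem_subdifferential_iff.1 hp
  obtain ⟨b, hb, hqb⟩ := mem_subdifferential_iff.1 hq
  have hpq : a + p.2 (q.1 - p.1) ≤ b := EReal.coe_le_coe_iff.1 (hb ▸ hpa q.1)
  have hqp : b + q.2 (p.1 - q.1) ≤ a := EReal.coe_le_coe_iff.1 (ha ▸ hqb p.1)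
  simp only [sub_apply, map_sub] at *
  linarith

theorem half_norm_sq_add_half_norm_sub_sq_le {p : StrongDual ℝ E} {s : E}
    (hp : p ∈ subdifferential (fun z => (((1 / 2 : ℝ) * ‖z - x‖ ^ 2 : ℝ) : EReal)) s) :
    (1 / 2 : ℝ) * ‖p‖ ^ 2 + (1 / 2 : ℝ) * ‖s - x‖ ^ 2 ≤ p (s - x) := by
  rw [← le_sub_iff_add_le]
  refine half_norm_sq_le_of_forall_sub_half_norm_sq_le fun w => ?_
  have hw := mem_subdifferential_coe_iff.1 hp (w + x)
  simp only [map_add, add_sub_cancel_right, map_sub] at *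
  linarith

end Subdifferential

section FitzpatrickExtension

variable {E : Type*} [NormedAddCommGroup E] [NormedSpace ℝ E] {S : E → Set (StrongDual ℝ E)}
  {f : E → EReal} {x : E} {x' y' : StrongDual ℝ E} {y'' : StrongDual ℝ (StrongDual ℝ E)}

theorem fitzpatrickFunction_le_coe_iff {p : E × StrongDual ℝ E} {c : ℝ} :
    fitzpatrickFunction S p ≤ c ↔ ∀ s ∈ graph S, p.2 s.1 + s.2 p.1 - s.2 s.1 ≤ c := by
  simp only [fitzpatrickFunction, iSup₂_le_iff, EReal.coe_le_coe_iff]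

theorem MonotoneMultifunction.inclusionInDoubleDual_mem_fitzpatrickExtension
    (hS : MonotoneMultifunction S) (hx : x' ∈ S x) :
    NormedSpace.inclusionInDoubleDual ℝ E x ∈ fitzpatrickExtension S x' := by
  have hval : fitzpatrickFunction S (x, x') = (x' x : ℝ) := by
    refine le_antisymm (fitzpatrickFunction_le_coe_iff.2 fun s hs => ?_)
      (le_iSup₂_of_le (x, x') hx (by simp))
    have hmono := hS (x, x') hx s hs
    simp only [sub_apply, map_sub] at *
    linarith
  refine le_antisymm (conjugate_le_coe_iff.2 fun q => ?_)
    (le_of_eq_of_le ?_ (coe_sub_le_conjugate hval _))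
  · refine le_iSup₂_of_le (x, x') hx (EReal.coe_le_coe_iff.2 ?_)
    simp only [ContinuousLinearMap.coprod_apply, NormedSpace.dual_def]
    linarith
  · simp

theorem nonempty_graph_of_mem_fitzpatrickExtension (h : y'' ∈ fitzpatrickExtension S y') :
    (graph S).Nonempty := by
  by_contra! hS
  have hbot (p : E × StrongDual ℝ E) : fitzpatrickFunction S p = ⊥ := by
    simp [fitzpatrickFunction, hS]
  have htop : conjugate (fitzpatrickFunction S) (y'.coprod y'') = ⊤ := by
    simp [conjugate, hbot]
  exact EReal.coe_ne_top _ (h.symm.trans htop)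

theorem fitzpatrickFunction_subdifferential_le (f : E → EReal) (x : E) (x' : StrongDual ℝ E) :
    fitzpatrickFunction (subdifferential f) (x, x') ≤ f x + conjugate f x' := by
  refine iSup₂_le fun ⟨s, s'⟩ hs => ?_
  obtain ⟨a, ha, hsub⟩ := mem_subdifferential_iff.1 hs
  calc ((x' s + s' x - s' s : ℝ) : EReal)
      = ((a + s' (x - s) : ℝ) : EReal) + ((x' s - a : ℝ) : EReal) := by
        rw [← EReal.coe_add, map_sub]
        congr 1
        ring
    _ ≤ f x + conjugate f x' := add_le_add (hsub x) (coe_sub_le_conjugate ha x')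

theorem coe_sub_le_add_conjugate_of_mem_fitzpatrickExtension
    (h : y'' ∈ fitzpatrickExtension (subdifferential f) y') (x : E) (x' : StrongDual ℝ E) :
    ((y' x + y'' x' - y'' y' : ℝ) : EReal) ≤ f x + conjugate f x' :=
  (conjugate_le_coe_iff.1 (le_of_eq h) (x, x')).trans <|
    fitzpatrickFunction_subdifferential_le f x x'

theorem fitzpatrickExtension_subdifferential_subset (f : E → EReal) (y' : StrongDual ℝ E) :
    fitzpatrickExtension (subdifferential f) y' ⊆ subdifferential (conjugate f) y' := by
  intro y'' hy
  have hconj_le (x' : StrongDual ℝ E) (b : ℝ) (hb : conjugate f x' ≤ b) :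
      conjugate f y' ≤ (b - y'' (x' - y') : ℝ) := by
    refine conjugate_le_coe_iff.2 fun x => ?_
    calc ((y' x - (b - y'' (x' - y')) : ℝ) : EReal)
        = ((y' x + y'' x' - y'' y' : ℝ) : EReal) - b := by
          rw [← EReal.coe_sub, map_sub]
          congr 1
          ring
      _ ≤ f x := EReal.sub_le_of_le_add <|
          (coe_sub_le_add_conjugate_of_mem_fitzpatrickExtension hy x x').trans (by gcongr)
  obtain ⟨⟨s, s'⟩, hs⟩ := nonempty_graph_of_mem_fitzpatrickExtension hy
  obtain ⟨a, ha, hs'⟩ := mem_subdifferential_iff_conjugate_eq.1 hs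
  obtain ⟨c, hc⟩ : ∃ c : ℝ, conjugate f y' = c :=
    ⟨_, (EReal.coe_toReal (ne_top_of_le_ne_top (EReal.coe_ne_top _) (hconj_le s' _ hs'.le))
      (ne_bot_of_le_ne_bot (EReal.coe_ne_bot _) (coe_sub_le_conjugate ha y'))).symm⟩
  refine mem_subdifferential_iff.2 ⟨c, hc, fun x' => EReal.le_of_forall_lt_iff_le.1 fun b hb => ?_⟩
  have hcb : c ≤ b - y'' (x' - y') := EReal.coe_le_coe_iff.1 (hc ▸ hconj_le x' b hb.le)
  exact EReal.coe_le_coe_iff.2 (le_sub_iff_add_le.1 hcb)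

end FitzpatrickExtension

section NormalCone

variable {E : Type*} [NormedAddCommGroup E] [NormedSpace ℝ E] {K : Set E} {x s : E}
  {x' y' : StrongDual ℝ E} {y'' : StrongDual ℝ (StrongDual ℝ E)}

theorem conjugate_indicatorFun (K : Set E) (x' : StrongDual ℝ E) :
    conjugate (indicatorFun K) x' = ⨆ x ∈ K, ((x' x : ℝ) : EReal) := by
  refine iSup_congr fun x => ?_
  by_cases hx : x ∈ K <;> simp [indicatorFun, hx]

theorem mem_normalCone_iff : x' ∈ normalCone K x ↔ x ∈ K ∧ ∀ k ∈ K, x' k ≤ x' x := by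
  rw [normalCone, mem_subdifferential_iff]
  by_cases hx : x ∈ K
  · have hsub (k : E) :
        ((0 + x' (k - x) : ℝ) : EReal) ≤ indicatorFun K k ↔ (k ∈ K → x' k ≤ x' x) := by
      by_cases hk : k ∈ K <;> simp [indicatorFun, hk, -EReal.coe_sub]
    have hval : indicatorFun K x = 0 := if_pos hx
    constructor
    · rintro ⟨a, ha, h⟩
      obtain rfl : a = 0 := EReal.coe_eq_zero.1 (ha.symm.trans hval)
      exact ⟨hx, fun k => (hsub k).1 (h k)⟩
    · rintro ⟨-, h⟩
      exact ⟨0, hval, fun k => (hsub k).2 (h k)⟩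
  · simp [indicatorFun, hx]

theorem closedMultifunction_normalCone (hK : IsClosed K) :
    ClosedMultifunction (normalCone K) := by
  have hgraph : graph (normalCone K) = {p | p.1 ∈ K} ∩ ⋂ k ∈ K, {p | p.2 k ≤ p.2 p.1} := by
    ext p
    simp [graph, mem_normalCone_iff]
  rw [ClosedMultifunction, hgraph]
  refine (hK.preimage continuous_fst).inter (isClosed_biInter fun k _ => ?_)
  exact isClosed_le (by fun_prop) (by fun_prop)

theorem exists_mem_subdifferential_sub_mem_normalCone {h : E → ℝ}
    (hh : ConvexOn ℝ Set.univ h) (hhc : Continuous h) (hK : Convex ℝ K) (hs : s ∈ K)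
    (hmin : IsMinOn (fun z => h z - x' z) K s) :
    ∃ p ∈ subdifferential (fun z => (h z : EReal)) s, x' - p ∈ normalCone K s := by
  have haff : ConcaveOn ℝ K fun z => x' z + (h s - x' s) :=
    (x'.toLinearMap.concaveOn hK).add_const _
  obtain ⟨p, c, hp_le, hle_p⟩ := exists_affine_between_concaveOn_convexOn hh hhc ⟨s, hs⟩ haff
    fun k hk => by linarith [isMinOn_iff.1 hmin k hk]
  have hc : c = h s - p s := by linarith [hp_le s, hle_p s hs]
  refine ⟨p, mem_subdifferential_coe_iff.2 fun z => ?_, mem_normalCone_iff.2 ⟨hs, fun k hk => ?_⟩⟩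
  · rw [map_sub]
    linarith [hp_le z]
  · simp only [sub_apply]
    linarith [hle_p k hk]

theorem IsWeaklyCompact.isClosed (hK : IsWeaklyCompact K) : IsClosed K := by
  have hpre := (IsCompact.isClosed hK).preimage (map_continuous (toWeakSpaceCLM ℝ E))
  rwa [funext (toWeakSpaceCLM_eq_toWeakSpace (𝕜 := ℝ) (E := E)),
    Set.preimage_image_eq _ (toWeakSpace ℝ E).injective] at hpre

theorem IsWeaklyCompact.exists_isMinOn (hK : IsWeaklyCompact K) (hne : K.Nonempty) {f : E → ℝ}
    (hf : ConvexOn ℝ Set.univ f) (hfc : LowerSemicontinuous f) : ∃ s ∈ K, IsMinOn f K s := by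
  obtain ⟨_, ⟨s, hs, rfl⟩, hmin⟩ := LowerSemicontinuousOn.exists_isMinOn (hne.image _) hK
    ((lowerSemicontinuous_comp_toWeakSpace_symm hf hfc).lowerSemicontinuousOn _)
  exact ⟨s, hs, fun k hk => by simpa using hmin (Set.mem_image_of_mem _ hk)⟩

theorem quasidense_normalCone (hne : K.Nonempty) (hconv : Convex ℝ K) (hK : IsWeaklyCompact K) :
    Quasidense (normalCone K) := by
  intro x x'
  have hsq : ConvexOn ℝ Set.univ fun z : E => (1 / 2 : ℝ) * ‖z - x‖ ^ 2 := by
    have hnorm : ConvexOn ℝ Set.univ fun z : E => ‖z - x‖ := by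
      simpa only [dist_eq_norm] using convexOn_univ_dist x
    exact (hnorm.pow (fun _ _ => norm_nonneg _) 2).smul (by norm_num)
  obtain ⟨s, hs, hmin⟩ := hK.exists_isMinOn hne
    (hsq.sub (x'.toLinearMap.concaveOn convex_univ)) (Continuous.lowerSemicontinuous (by fun_prop))
  obtain ⟨p, hp, hnormal⟩ :=
    exists_mem_subdifferential_sub_mem_normalCone hsq (by fun_prop) hconv hs hmin
  refine iInf₂_le_of_le (s, x' - p) hnormal ?_
  rw [← EReal.coe_zero, EReal.coe_le_coe_iff, sub_sub_cancel_left, norm_neg, neg_apply]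
  linarith [half_norm_sq_add_half_norm_sub_sq_le hp]

theorem mem_subdifferential_conjugate_indicatorFun_iff :
    y'' ∈ subdifferential (conjugate (indicatorFun K)) y' ↔
      (∀ x', (y'' x' : EReal) ≤ ⨆ x ∈ K, ((x' x : ℝ) : EReal)) ∧
        (y'' y' : EReal) = ⨆ x ∈ K, ((y' x : ℝ) : EReal) := by
  simp only [← conjugate_indicatorFun]
  refine mem_subdifferential_iff_of_sublinear ?_ fun x' z' => ?_
  · simp [conjugate_indicatorFun]
  · simp only [conjugate_indicatorFun]
    refine iSup₂_le fun x hx => ?_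
    rw [add_apply, EReal.coe_add]
    exact add_le_add (le_iSup₂_of_le x hx le_rfl) (le_iSup₂_of_le x hx le_rfl)

theorem IsWeaklyCompact.mem_image_inclusionInDoubleDual (hK : IsWeaklyCompact K)
    (hconv : Convex ℝ K) (hle : ∀ x', (y'' x' : EReal) ≤ ⨆ x ∈ K, ((x' x : ℝ) : EReal)) :
    y'' ∈ NormedSpace.inclusionInDoubleDual ℝ E '' K := by
  let ι := NormedSpace.inclusionInDoubleDualWeak ℝ E
  have hclosed : IsClosed (ι '' (toWeakSpace ℝ E '' K)) :=
    (IsCompact.image hK ι.continuous).isClosed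
  have hconv' : Convex ℝ (ι '' (toWeakSpace ℝ E '' K)) :=
    (hconv.linear_image (toWeakSpace ℝ E).toLinearMap).linear_image ι.toLinearMap
  by_contra hy
  have hy' : StrongDual.toWeakDual y'' ∉ ι '' (toWeakSpace ℝ E '' K) := by
    rintro ⟨_, ⟨k, hk, rfl⟩, hk'⟩
    exact hy ⟨k, hk, hk'⟩
  obtain ⟨x', b, hlt, hgt⟩ := exists_forall_lt_of_notMem_weakDual hconv' hclosed hy'
  have hsup : ⨆ x ∈ K, ((x' x : ℝ) : EReal) ≤ b := iSup₂_le fun k hk =>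
    EReal.coe_le_coe_iff.2 (hlt _ ⟨_, ⟨k, hk, rfl⟩, rfl⟩).le
  exact hgt.not_ge (EReal.coe_le_coe_iff.1 ((hle x').trans hsup))

theorem mem_fitzpatrickExtension_normalCone_iff (hconv : Convex ℝ K) (hK : IsWeaklyCompact K) :
    y'' ∈ fitzpatrickExtension (normalCone K) y' ↔
      y'' ∈ NormedSpace.inclusionInDoubleDual ℝ E '' K ∧
        ((y'' y' : ℝ) : EReal) = ⨆ x ∈ K, ((y' x : ℝ) : EReal) := by
  constructor
  · intro hy
    obtain ⟨hle, heq⟩ := mem_subdifferential_conjugate_indicatorFun_iff.1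
      (fitzpatrickExtension_subdifferential_subset _ _ hy)
    exact ⟨hK.mem_image_inclusionInDoubleDual hconv hle, heq⟩
  · rintro ⟨⟨k, hk, rfl⟩, heq⟩
    rw [NormedSpace.dual_def] at heq
    have hnormal : y' ∈ normalCone K k := mem_normalCone_iff.2 ⟨hk, fun x hx =>
      EReal.coe_le_coe_iff.1 (heq ▸ le_iSup₂_of_le x hx le_rfl)⟩
    exact (monotoneMultifunction_subdifferential _).inclusionInDoubleDual_mem_fitzpatrickExtension
      hnormal

end NormalCone

end FitzpatrickExt

theorem mainTheorem11_general {E : Type*} [NormedAddCommGroup E] [NormedSpace ℝ E]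
    (K : Set E) (hne : K.Nonempty) (hconv : Convex ℝ K)
    (hcpt : FitzpatrickExt.IsWeaklyCompact K) :
    (FitzpatrickExt.ClosedMultifunction (FitzpatrickExt.normalCone K) ∧
      FitzpatrickExt.MonotoneMultifunction (FitzpatrickExt.normalCone K) ∧
      FitzpatrickExt.Quasidense (FitzpatrickExt.normalCone K)) ∧
    ∀ (y' : StrongDual ℝ E) (y'' : StrongDual ℝ (StrongDual ℝ E)),
      (y', y'') ∈
          FitzpatrickExt.graph
            (FitzpatrickExt.fitzpatrickExtension (FitzpatrickExt.normalCone K)) ↔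
        y'' ∈ NormedSpace.inclusionInDoubleDual ℝ E '' K ∧
          ((y'' y' : ℝ) : EReal) = ⨆ x ∈ K, ((y' x : ℝ) : EReal) :=
  ⟨⟨FitzpatrickExt.closedMultifunction_normalCone hcpt.isClosed,
    FitzpatrickExt.monotoneMultifunction_subdifferential _,
    FitzpatrickExt.quasidense_normalCone hne hconv hcpt⟩,
    fun _ _ => FitzpatrickExt.mem_fitzpatrickExtension_normalCone_iff hconv hcpt⟩

theorem mainTheorem11 {E : Type*} [NormedAddCommGroup E] [NormedSpace ℝ E] [CompleteSpace E]
    (K : Set E) (hne : K.Nonempty) (hconv : Convex ℝ K)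
    (hcpt : FitzpatrickExt.IsWeaklyCompact K) :
    (FitzpatrickExt.ClosedMultifunction (FitzpatrickExt.normalCone K) ∧
      FitzpatrickExt.MonotoneMultifunction (FitzpatrickExt.normalCone K) ∧
      FitzpatrickExt.Quasidense (FitzpatrickExt.normalCone K)) ∧
    ∀ (y' : StrongDual ℝ E) (y'' : StrongDual ℝ (StrongDual ℝ E)),
      (y', y'') ∈
          FitzpatrickExt.graph
            (FitzpatrickExt.fitzpatrickExtension (FitzpatrickExt.normalCone K)) ↔
        y'' ∈ NormedSpace.inclusionInDoubleDual ℝ E '' K ∧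
          ((y'' y' : ℝ) : EReal) = ⨆ x ∈ K, ((y' x : ℝ) : EReal) :=
  mainTheorem11_general K hne hconv hcpt
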